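/- Let $Y_1,Y_2,\dots$ be i.i.d. real random variables and $X_k=e^{Y_k}$, where the $X_k$ are in the log-exponential-power class with exponent $\rho>1$: the distribution function $F$ of $Y_1$ is continuous, $1-F(y)=e^{-h(y)}$ for all $y\in\mathbb R$ with $h$ real-valued, and $h(y)=L(y)\,y^{\rho}$ for $y>0$, where $L$ is twice differentiable on $(0,\infty)$, slowly varying (that is, $L(ty)/L(y)\to1$ as $y\to+\infty$ for every $t>0$) and satisfies $$\lim_{y\to+\infty} y\,\frac{L'(y)}{L(y)}=0,\qquad \lim_{y\to+\infty}\Bigl(y\,\frac{L'(y)}{L(y)}\Bigr)'=0 .$$ For $n\ge 2$ let $y^\dagger(n)=\inf\{y: h(y)\ge\ln n\}$, so that $h(y^\dagger(n))=\ln n$. For $q\ge 0$ define the sample moment and the truncated moment by $$S(n,q)=\frac1n\sum_{k=1}^n X_k^{q},\qquad M_T(n,q)=\int_0^{y^\dagger(n)} h'(y)\,e^{qy-h(y)}\,dy .$$ Let $q(n)\ge 0$ satisfy, for some $\varepsilon>0$, $q(n)=o\bigl((\ln n)^{2-1/\rho-\varepsilon}\bigr)$ as $n\to\infty$. Then $M_T(n,q(n))>0$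 for all large $n$, and almost surely $$\frac{\ln S(n,q(n))}{\ln n}-\frac{\ln M_T(n,q(n))}{\ln n}\;\longrightarrow\;0\qquad(n\to\infty).$$ In particular, whenever $\ell=\lim_{n\to\infty}\ln M_T(n,q(n))/\ln n$ exists in $[-\infty,+\infty]$, $\ln S(n,q(n))/\ln n\to\ell$ almost surely. -/

import Mathlib

open MeasureTheory ProbabilityTheory Filter Topology Set Asymptotics

noncomputable section

namespace LogExpPower

/-- The function `h` attached to a law `ν` on `ℝ` with distribution function `F`:
`h(y) = -ln (1 - F(y))`. -/
def tailExponent (ν : Measure ℝ) (y : ℝ) : ℝ :=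
  -Real.log (1 - cdf ν y)

/-- `L` is slowly varying at `+∞`. -/
def SlowlyVarying (L : ℝ → ℝ) : Prop :=
  ∀ t : ℝ, 0 < t → Tendsto (fun y => L (t * y) / L y) atTop (𝓝 1)

/-- The law `ν` of `Y = ln X`, for `X` in the log-exponential-power class with exponent `ρ`. The
function `L` is considered on `(0, ∞)`, where `h(y) = L(y) y ^ ρ`. -/
structure IsLogExpPower (ν : Measure ℝ) (ρ : ℝ) : Prop where
  one_lt : 1 < ρ
  continuous_cdf : Continuous (cdf ν)
  tail : ∀ y : ℝ, 1 - cdf ν y = Real.exp (-tailExponent ν y)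
  regular : ∃ L : ℝ → ℝ,
    (∀ y : ℝ, 0 < y → tailExponent ν y = L y * y ^ ρ) ∧
    SlowlyVarying L ∧
    DifferentiableOn ℝ L (Ioi 0) ∧
    DifferentiableOn ℝ (deriv L) (Ioi 0) ∧
    Tendsto (fun y => y * (deriv L y / L y)) atTop (𝓝 0) ∧
    Tendsto (deriv fun y => y * (deriv L y / L y)) atTop (𝓝 0)

/-- The frontier `y†(n) = h⁻¹(ln n)`; see `tailExponent_yDagger`. -/
def yDagger (ν : Measure ℝ) (n : ℕ) : ℝ :=
  sInf {y : ℝ | Real.log n ≤ tailExponent ν y}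

/-- The truncated moment `M_T(n, q) = ∫_0^{y†(n)} e^{q y - h(y) + ln h'(y)} dy`; the factor
`e^{ln h'(y)}` is written `h'(y)`, which is the right value (zero) also where `h'(y) = 0`. -/
def truncatedMoment (ν : Measure ℝ) (n : ℕ) (q : ℝ) : ℝ :=
  ∫ y in (0 : ℝ)..yDagger ν n, Real.exp (q * y - tailExponent ν y) * deriv (tailExponent ν) y

/-- The sample moment `S(n, q) = (1 / n) ∑ X_k ^ q` over the first `n` members of the sequence. -/
def sampleMoment {Ω : Type*} (X : ℕ → Ω → ℝ) (n : ℕ) (q : ℝ) (ω : Ω) : ℝ :=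
  (1 / (n : ℝ)) * ∑ k ∈ Finset.range n, X k ω ^ q

/-- The frontier solves `h(y†(n)) = ln n`. -/
theorem tailExponent_yDagger {ν : Measure ℝ} {ρ : ℝ} (hν : IsLogExpPower ν ρ) {n : ℕ}
    (hn : 2 ≤ n) : tailExponent ν (yDagger ν n) = Real.log n := by
  have hpos : ∀ y, 0 < 1 - cdf ν y := fun y => by rw [hν.tail y]; exact Real.exp_pos _
  have hcont : Continuous (tailExponent ν) := by
    unfold tailExponent
    exact ((continuous_const.sub hν.continuous_cdf).log fun y => (hpos y).ne').neg
  have hmono : Monotone (tailExponent ν) := fun a b hab => by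
    unfold tailExponent
    have := monotone_cdf ν hab
    exact neg_le_neg (Real.log_le_log (hpos b) (by linarith))
  have hn1 : (1 : ℝ) < n := by exact_mod_cast (by omega : 1 < n)
  have hlog : 0 < Real.log n := Real.log_pos hn1
  have hbot : Tendsto (tailExponent ν) atBot (𝓝 0) := by
    have h1 : Tendsto (fun y => 1 - cdf ν y) atBot (𝓝 (1 - 0)) :=
      tendsto_const_nhds.sub (tendsto_cdf_atBot ν)
    have h2 := (h1.log (by norm_num)).neg
    have h3 : tailExponent ν = fun y => -Real.log (1 - cdf ν y) := rfl
    rw [h3]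
    simpa using h2
  obtain ⟨a, ha⟩ := (hbot.eventually (gt_mem_nhds hlog)).exists
  have hinv : (n : ℝ)⁻¹ < 1 := inv_lt_one_of_one_lt₀ hn1
  have hinv0 : 0 < (n : ℝ)⁻¹ := by positivity
  obtain ⟨b, hb⟩ := ((tendsto_cdf_atTop ν).eventually
    (lt_mem_nhds (show 1 - (n : ℝ)⁻¹ < 1 by linarith))).exists
  have hb' : Real.log n ≤ tailExponent ν b := by
    have h3 : Real.log (1 - cdf ν b) ≤ Real.log ((n : ℝ)⁻¹) :=
      Real.log_le_log (hpos b) (by linarith)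
    rw [Real.log_inv] at h3
    unfold tailExponent
    linarith
  have hne : {y : ℝ | Real.log n ≤ tailExponent ν y}.Nonempty := ⟨b, hb'⟩
  have hbdd : BddBelow {y : ℝ | Real.log n ≤ tailExponent ν y} := ⟨a, fun y hy => by
    by_contra hlt
    have h4 : tailExponent ν y ≤ tailExponent ν a := hmono (not_le.mp hlt).le
    have h5 : Real.log n ≤ tailExponent ν y := hy
    linarith⟩
  have hclosed : IsClosed {y : ℝ | Real.log n ≤ tailExponent ν y} :=
    isClosed_le continuous_const hcont
  have hge : Real.log n ≤ tailExponent ν (yDagger ν n) := hclosed.csInf_mem hne hbdd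
  refine le_antisymm ?_ hge
  have hab : a ≤ yDagger ν n := by
    by_contra hlt
    have := hmono (not_le.mp hlt).le
    linarith
  obtain ⟨c, hc, hc'⟩ := intermediate_value_Icc hab hcont.continuousOn ⟨ha.le, hge⟩
  have hcf : yDagger ν n ≤ c := csInf_le hbdd (show Real.log n ≤ tailExponent ν c from hc'.ge)
  exact (hmono hcf).trans hc'.le

end LogExpPower

end

/-! ### Chernoff bounds and Borel–Cantelli. -/

namespace LogExpPower

/-! Write u = ln n, d = y†(n), and take levels a < d < b with h(a) = u - 2 ln u and h(b) = u + 2 ln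
u. Almost surely the maximum of the first n variables eventually lies in (a, b]. Below such a level,
e^{q(Y - level)} takes values in [0, 1], so Chernoff bounds and Borel–Cantelli compare its sum with
its mean, uniformly in q.

What is left out of the comparison is of order e^{qa}/n up to powers of u and the factor e^{q(b-a)}.
This quantity is controlled on both sides: it is at most M_T because (a, d] has mass at least 1/n,
and at most S because the maximum exceeds a. Hence S and M_T agree up to a factor K u² e^{q(b-a)}
(`empirical_le_mul_setIntegral`, `setIntegral_le_mul_empirical`).

The growth condition on q enters only in `tendsto_mul_sub_div_log`. Monotonicity of h(y)/y gives b -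
a = O(a ln u / u), and a = O(u^{1/ρ + ε/2}), so q(b - a) = o(u). -/

theorem exp_le_one_add_two_mul {z : ℝ} (h0 : 0 ≤ z) (h1 : z ≤ 1) : Real.exp z ≤ 1 + 2 * z := by
  have h := convexOn_exp.2 (mem_univ (0 : ℝ)) (mem_univ (1 : ℝ)) (by linarith : 0 ≤ 1 - z) h0
    (by ring)
  simp only [smul_eq_mul, mul_zero, mul_one, zero_add, Real.exp_zero] at h
  nlinarith [Real.exp_one_lt_d9]

theorem exp_neg_le_one_sub_mul {z : ℝ} (h0 : 0 ≤ z) (h1 : z ≤ 1) :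
    Real.exp (-z) ≤ 1 - 3 / 5 * z := by
  have h := convexOn_exp.2 (mem_univ (0 : ℝ)) (mem_univ (-1 : ℝ)) (by linarith : 0 ≤ 1 - z) h0
    (by ring)
  simp only [smul_eq_mul, mul_zero, mul_one, zero_add, Real.exp_zero, mul_neg] at h
  nlinarith [Real.exp_neg_one_lt_d9]

section Chernoff

variable {Ω : Type*} [MeasurableSpace Ω] {μ : Measure Ω} [IsProbabilityMeasure μ]
  {Y : ℕ → Ω → ℝ} {f : ℝ → ℝ}

theorem integrable_of_mem_unitInterval {ν : Measure ℝ} [IsFiniteMeasure ν] (hf : Measurable f)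
    (h0 : ∀ x, 0 ≤ f x) (h1 : ∀ x, f x ≤ 1) : Integrable f ν :=
  Integrable.of_bound hf.aestronglyMeasurable 1
    (ae_of_all _ fun x => by rw [Real.norm_of_nonneg (h0 x)]; exact h1 x)

/-- A linear majorant of the exponential on [0, 1] turns the moment generating function into 1 + c E
f ≤ e^{c E f}. Keeping t and c general serves both tails. -/
theorem mgf_comp_le (hmeas : ∀ k, Measurable (Y k))
    (hident : ∀ k, IdentDistrib (Y k) (Y 0) μ μ) (hf : Measurable f)
    (h0 : ∀ x, 0 ≤ f x) (h1 : ∀ x, f x ≤ 1) {t c : ℝ}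
    (hc : ∀ z, 0 ≤ z → z ≤ 1 → Real.exp (t * z) ≤ 1 + c * z) (k : ℕ) :
    mgf (fun ω => f (Y k ω)) μ t ≤ Real.exp (c * ∫ x, f x ∂(μ.map (Y 0))) := by
  have : IsProbabilityMeasure (μ.map (Y 0)) := Measure.isProbabilityMeasure_map (hmeas 0).aemeasurable
  have hint : Integrable f (μ.map (Y 0)) := integrable_of_mem_unitInterval hf h0 h1
  have hexp : Measurable fun x => Real.exp (t * f x) := by fun_prop
  calc mgf (fun ω => f (Y k ω)) μ t = ∫ x, Real.exp (t * f x) ∂(μ.map (Y k)) := by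
        rw [mgf, integral_map (hmeas k).aemeasurable hexp.aestronglyMeasurable]
    _ = ∫ x, Real.exp (t * f x) ∂(μ.map (Y 0)) := by rw [(hident k).map_eq]
    _ ≤ ∫ x, (1 + c * f x) ∂(μ.map (Y 0)) :=
        integral_mono_of_nonneg (ae_of_all _ fun x => (Real.exp_pos _).le)
          ((integrable_const _).add (hint.const_mul c))
          (ae_of_all _ fun x => hc _ (h0 x) (h1 x))
    _ = c * (∫ x, f x ∂(μ.map (Y 0))) + 1 := by
        rw [integral_add (integrable_const _) (hint.const_mul c), integral_const_mul]
        simp [add_comm]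
    _ ≤ _ := Real.add_one_le_exp _

theorem mgf_sum_comp_le (hmeas : ∀ k, Measurable (Y k)) (hindep : iIndepFun Y μ)
    (hident : ∀ k, IdentDistrib (Y k) (Y 0) μ μ) (hf : Measurable f)
    (h0 : ∀ x, 0 ≤ f x) (h1 : ∀ x, f x ≤ 1) {t c : ℝ}
    (hc : ∀ z, 0 ≤ z → z ≤ 1 → Real.exp (t * z) ≤ 1 + c * z) (n : ℕ) :
    mgf (fun ω => ∑ k ∈ Finset.range n, f (Y k ω)) μ t
      ≤ Real.exp (c * (n * ∫ x, f x ∂(μ.map (Y 0)))) := by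
  have hind : iIndepFun (fun k ω => f (Y k ω)) μ := hindep.comp (fun _ => f) fun _ => hf
  have hsum : (fun ω => ∑ k ∈ Finset.range n, f (Y k ω))
      = ∑ k ∈ Finset.range n, fun ω => f (Y k ω) := by
    ext ω; simp
  rw [hsum, hind.mgf_sum (fun k => hf.comp (hmeas k))]
  refine (Finset.prod_le_prod (fun k _ => mgf_nonneg)
    fun k _ => mgf_comp_le hmeas hident hf h0 h1 hc k).trans_eq ?_
  rw [Finset.prod_const, Finset.card_range, ← Real.exp_nat_mul]
  congr 1; ring

theorem integrable_exp_mul_sum (hmeas : ∀ k, Measurable (Y k)) (hf : Measurable f)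
    (h0 : ∀ x, 0 ≤ f x) (h1 : ∀ x, f x ≤ 1) (t : ℝ) (n : ℕ) :
    Integrable (fun ω => Real.exp (t * ∑ k ∈ Finset.range n, f (Y k ω))) μ := by
  refine Integrable.of_bound (C := Real.exp (|t| * n)) ?_ (ae_of_all _ fun ω => ?_)
  · have : ∀ k, Measurable fun ω => f (Y k ω) := fun k => hf.comp (hmeas k)
    exact Measurable.aestronglyMeasurable (by fun_prop)
  · rw [Real.norm_of_nonneg (Real.exp_pos _).le]
    have hs0 : 0 ≤ ∑ k ∈ Finset.range n, f (Y k ω) := Finset.sum_nonneg fun k _ => h0 _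
    have hs1 : ∑ k ∈ Finset.range n, f (Y k ω) ≤ n := by
      simpa using Finset.sum_le_card_nsmul (Finset.range n) (fun k => f (Y k ω)) 1 fun k _ => h1 _
    exact Real.exp_le_exp.mpr ((mul_le_mul_of_nonneg_right (le_abs_self t) hs0).trans
      (mul_le_mul_of_nonneg_left hs1 (abs_nonneg t)))

/-- Chernoff's bound for the upper tail of a sum of i.i.d. variables with values in `[0, 1]`. -/
theorem measureReal_sum_ge_le (hmeas : ∀ k, Measurable (Y k)) (hindep : iIndepFun Y μ)
    (hident : ∀ k, IdentDistrib (Y k) (Y 0) μ μ) (hf : Measurable f)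
    (h0 : ∀ x, 0 ≤ f x) (h1 : ∀ x, f x ≤ 1) (n : ℕ) (t : ℝ) :
    μ.real {ω | 2 * (n * ∫ x, f x ∂(μ.map (Y 0))) + t ≤ ∑ k ∈ Finset.range n, f (Y k ω)}
      ≤ Real.exp (-t) := by
  refine (measure_ge_le_exp_mul_mgf _ zero_le_one
    (integrable_exp_mul_sum hmeas hf h0 h1 1 n)).trans ?_
  refine (mul_le_mul_of_nonneg_left (mgf_sum_comp_le hmeas hindep hident hf h0 h1 (c := 2)
    (fun z hz0 hz1 => by simpa using exp_le_one_add_two_mul hz0 hz1) n)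
    (Real.exp_pos _).le).trans_eq ?_
  rw [← Real.exp_add]
  congr 1; ring

/-- Chernoff's bound for the lower tail of a sum of i.i.d. variables with values in `[0, 1]`. -/
theorem measureReal_sum_le_le (hmeas : ∀ k, Measurable (Y k)) (hindep : iIndepFun Y μ)
    (hident : ∀ k, IdentDistrib (Y k) (Y 0) μ μ) (hf : Measurable f)
    (h0 : ∀ x, 0 ≤ f x) (h1 : ∀ x, f x ≤ 1) (n : ℕ) :
    μ.real {ω | ∑ k ∈ Finset.range n, f (Y k ω) ≤ (n * ∫ x, f x ∂(μ.map (Y 0))) / 2}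
      ≤ Real.exp (-((n * ∫ x, f x ∂(μ.map (Y 0))) / 10)) := by
  -- With m the mean of the sum, t = -1 gives e^{m/2} e^{-3m/5} = e^{-m/10}.
  refine (measure_le_le_exp_mul_mgf (t := -1) _ (by norm_num)
    (integrable_exp_mul_sum hmeas hf h0 h1 (-1) n)).trans ?_
  refine (mul_le_mul_of_nonneg_left (mgf_sum_comp_le hmeas hindep hident hf h0 h1 (c := -(3 / 5))
    (fun z hz0 hz1 => by
      have := exp_neg_le_one_sub_mul hz0 hz1
      rw [neg_one_mul]; linarith) n)
    (Real.exp_pos _).le).trans_eq ?_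
  rw [← Real.exp_add]
  congr 1; ring

end Chernoff

theorem ae_eventually_notMem_of_summable {Ω : Type*} [MeasurableSpace Ω] {μ : Measure Ω}
    [IsFiniteMeasure μ] {s : ℕ → Set Ω} {a : ℕ → ℝ} (ha : Summable a)
    (h : ∀ᶠ n in atTop, μ.real (s n) ≤ a n) : ∀ᵐ ω ∂μ, ∀ᶠ n in atTop, ω ∉ s n := by
  have hs : Summable fun n => μ.real (s n) :=
    ha.of_norm_bounded_eventually_nat (by
      filter_upwards [h] with n hn
      rwa [Real.norm_of_nonneg measureReal_nonneg])
  refine ae_eventually_notMem ?_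
  have : (∑' n, μ (s n)) = ∑' n, ENNReal.ofReal (μ.real (s n)) := by
    congr 1; ext n; exact (ofReal_measureReal (measure_ne_top _ _)).symm
  rw [this]
  exact hs.tsum_ofReal_ne_top

theorem summable_one_div_mul_log_sq :
    Summable fun n : ℕ => 1 / ((n : ℝ) * Real.log n ^ 2) := by
  set f : ℕ → ℝ := fun n => 1 / ((n : ℝ) * Real.log n ^ 2)
  have hnn : ∀ n, 0 ≤ f n := fun n => by positivity
  refine (summable_condensed_iff_of_eventually_nonneg (f := f) (Eventually.of_forall hnn) ?_).mp ?_
  -- At n = 0 and n = 1 the term is the default 1/0 = 0, so it decreases only from n = 2 on.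
  · filter_upwards [eventually_ge_atTop 2] with n hn
    have h2 : (2 : ℝ) ≤ n := by exact_mod_cast hn
    have hl : 0 < Real.log n := Real.log_pos (by linarith)
    have hl' : Real.log n ≤ Real.log (n + 1 : ℕ) :=
      Real.log_le_log (by linarith) (by push_cast; linarith)
    refine one_div_le_one_div_of_le (by positivity) ?_
    gcongr
    simp
  · have h := (Real.summable_one_div_nat_pow (p := 2)).mpr (by norm_num)
    refine (h.mul_left (1 / Real.log 2 ^ 2)).congr fun k => ?_
    simp only [f]
    push_cast
    rw [Real.log_pow]
    rcases eq_or_ne k 0 with rfl | hk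
    · simp
    · have : (k : ℝ) ≠ 0 := by exact_mod_cast hk
      have := (Real.log_pos one_lt_two).ne'
      field_simp

end LogExpPower

/-! ### The tail exponent h and the density of the law on (0, ∞). -/

namespace LogExpPower

section Law

variable {ν : Measure ℝ} {ρ : ℝ}

theorem IsLogExpPower.one_sub_cdf_pos (hν : IsLogExpPower ν ρ) (y : ℝ) : 0 < 1 - cdf ν y := by
  rw [hν.tail y]; exact Real.exp_pos _

theorem IsLogExpPower.continuous_tailExponent (hν : IsLogExpPower ν ρ) :
    Continuous (tailExponent ν) :=
  ((continuous_const.sub hν.continuous_cdf).log fun y => (hν.one_sub_cdf_pos y).ne').neg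

theorem IsLogExpPower.monotone_tailExponent (hν : IsLogExpPower ν ρ) :
    Monotone (tailExponent ν) := fun a b hab =>
  neg_le_neg (Real.log_le_log (hν.one_sub_cdf_pos b) (by linarith [monotone_cdf ν hab]))

theorem IsLogExpPower.tendsto_tailExponent_atTop (hν : IsLogExpPower ν ρ) :
    Tendsto (tailExponent ν) atTop atTop := by
  refine tendsto_neg_atBot_atTop.comp (Real.tendsto_log_nhdsGT_zero.comp ?_)
  refine tendsto_nhdsWithin_iff.mpr ⟨?_, Eventually.of_forall hν.one_sub_cdf_pos⟩
  simpa using (tendsto_const_nhds (x := (1 : ℝ))).sub (tendsto_cdf_atTop ν)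

theorem IsLogExpPower.exists_tailExponent_eq (hν : IsLogExpPower ν ρ) {v : ℝ}
    (hv : tailExponent ν 0 ≤ v) : ∃ y, 0 ≤ y ∧ tailExponent ν y = v := by
  obtain ⟨b, hb, hb0⟩ := ((hν.tendsto_tailExponent_atTop.eventually_ge_atTop v).and
    (eventually_ge_atTop 0)).exists
  obtain ⟨c, hc, hc'⟩ := intermediate_value_Icc hb0 hν.continuous_tailExponent.continuousOn
    ⟨hv, hb⟩
  exact ⟨c, hc.1, hc'⟩

theorem IsLogExpPower.differentiableAt_tailExponent (hν : IsLogExpPower ν ρ) {y : ℝ}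
    (hy : 0 < y) : DifferentiableAt ℝ (tailExponent ν) y := by
  obtain ⟨L, hL, -, hd, -⟩ := hν.regular
  have h1 : DifferentiableAt ℝ (fun y => L y * y ^ ρ) y :=
    (hd.differentiableAt (Ioi_mem_nhds hy)).mul
      (Real.differentiableAt_rpow_const_of_ne ρ hy.ne')
  exact h1.congr_of_eventuallyEq (by
    filter_upwards [Ioi_mem_nhds hy] with z hz using hL z hz)

/-- `h(y) / y ^ s` is eventually nondecreasing for `s < ρ`. -/
theorem IsLogExpPower.exists_monotoneOn_log (hν : IsLogExpPower ν ρ) {s : ℝ} (hs : s < ρ) :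
    ∃ y₀, 0 < y₀ ∧ 0 < tailExponent ν y₀ ∧
      MonotoneOn (fun y => Real.log (tailExponent ν y) - s * Real.log y) (Ici y₀) := by
  obtain ⟨L, hL, -, hd, -, hlim, -⟩ := hν.regular
  -- The logarithmic derivative of h(y)/y^s is (y L'/L + ρ - s)/y, which is positive once y L'/L > s
  -- - ρ.
  obtain ⟨y₀, h₀⟩ := eventually_atTop.mp (((hlim.eventually_const_lt
    (show s - ρ < 0 by linarith)).and (hν.tendsto_tailExponent_atTop.eventually_gt_atTop 0)).and
    (eventually_gt_atTop 0))
  have hderiv : ∀ y ∈ Ici y₀, HasDerivAt (fun y => Real.log (tailExponent ν y) - s * Real.log y)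
      ((deriv L y / L y + ρ / y) - s * y⁻¹) y := fun y hy => by
    obtain ⟨⟨-, hpos⟩, hy0⟩ := h₀ y hy
    have h1 : HasDerivAt (fun y => L y * y ^ ρ)
        (deriv L y * y ^ ρ + L y * (ρ * y ^ (ρ - 1))) y :=
      (hd.differentiableAt (Ioi_mem_nhds hy0)).hasDerivAt.mul
        (Real.hasDerivAt_rpow_const (Or.inl hy0.ne'))
    have h2 : HasDerivAt (tailExponent ν) _ y := h1.congr_of_eventuallyEq (by
      filter_upwards [Ioi_mem_nhds hy0] with z hz using hL z hz)
    have hLy : L y ≠ 0 := fun h => by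
      rw [hL y hy0, h, zero_mul] at hpos
      exact lt_irrefl _ hpos
    refine ((h2.log hpos.ne').sub ((Real.hasDerivAt_log hy0.ne').const_mul s)).congr_deriv ?_
    congr 1
    rw [hL y hy0, Real.rpow_sub_one hy0.ne']
    have := (Real.rpow_pos_of_pos hy0 ρ).ne'
    field_simp
  refine ⟨y₀, (h₀ y₀ le_rfl).2, (h₀ y₀ le_rfl).1.2, monotoneOn_of_hasDerivWithinAt_nonneg
    (convex_Ici y₀) (fun y hy => (hderiv y hy).continuousAt.continuousWithinAt)
    (fun y hy => (hderiv y (interior_subset hy)).hasDerivWithinAt) fun y hy => ?_⟩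
  obtain ⟨⟨hlt, -⟩, hy0⟩ := h₀ y (interior_subset hy)
  have : deriv L y / L y + ρ / y - s * y⁻¹ = (y * (deriv L y / L y) - (s - ρ)) / y := by
    field_simp; ring
  rw [this]
  exact div_nonneg (by linarith) hy0.le

variable [IsProbabilityMeasure ν]

theorem IsLogExpPower.measureReal_Ioi (hν : IsLogExpPower ν ρ) (y : ℝ) :
    ν.real (Ioi y) = Real.exp (-tailExponent ν y) := by
  rw [← hν.tail, cdf_eq_real, ← compl_Iic, probReal_compl_eq_one_sub measurableSet_Iic]

theorem IsLogExpPower.measureReal_Ioc (hν : IsLogExpPower ν ρ) {a b : ℝ} (hab : a ≤ b) :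
    ν.real (Ioc a b) = Real.exp (-tailExponent ν a) - Real.exp (-tailExponent ν b) := by
  rw [← hν.measureReal_Ioi, ← hν.measureReal_Ioi, ← Ioi_sdiff_Ioi,
    measureReal_sdiff (Ioi_subset_Ioi hab) measurableSet_Ioi]

/-- Both measures give (a, b] the increment of -e^{-h} over its part in (0, ∞). Since h is monotone,
the derivative of -e^{-h} is nonnegative, and its integrability follows without any continuity of
h'. -/
theorem IsLogExpPower.restrict_Ioi_eq_withDensity (hν : IsLogExpPower ν ρ) :
    ν.restrict (Ioi 0) = (volume.restrict (Ioi 0)).withDensity fun y =>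
      ENNReal.ofReal (Real.exp (-tailExponent ν y) * deriv (tailExponent ν) y) := by
  refine Measure.ext_of_Ioc _ _ fun a b hab => ?_
  rw [withDensity_apply _ measurableSet_Ioc, Measure.restrict_apply measurableSet_Ioc,
    Measure.restrict_restrict measurableSet_Ioc, Ioc_inter_Ioi]
  rcases le_total b (a ⊔ 0) with hb | hb
  · simp [Ioc_eq_empty_of_le hb]
  have h0 : 0 ≤ a ⊔ 0 := le_sup_right
  have hcont : ContinuousOn (fun y => -Real.exp (-tailExponent ν y)) (Icc (a ⊔ 0) b) :=
    (Real.continuous_exp.comp hν.continuous_tailExponent.neg).neg.continuousOn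
  have hderiv : ∀ y ∈ Ioo (a ⊔ 0) b, HasDerivAt (fun y => -Real.exp (-tailExponent ν y))
      (Real.exp (-tailExponent ν y) * deriv (tailExponent ν) y) y := fun y hy => by
    exact (hν.differentiableAt_tailExponent (h0.trans_lt hy.1)).hasDerivAt.neg.exp.neg.congr_deriv
      (by simp)
  have hnn : ∀ y, 0 ≤ Real.exp (-tailExponent ν y) * deriv (tailExponent ν) y := fun y =>
    mul_nonneg (Real.exp_pos _).le hν.monotone_tailExponent.deriv_nonneg
  have hint := intervalIntegral.integrableOn_deriv_of_nonneg hcont hderiv fun y _ => hnn y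
  rw [← ofReal_integral_eq_lintegral_ofReal hint (ae_of_all _ hnn),
    ← intervalIntegral.integral_of_le hb,
    intervalIntegral.integral_eq_sub_of_hasDerivAt_of_le hb hcont hderiv
      ((intervalIntegrable_iff_integrableOn_Ioc_of_le hb).mpr hint),
    ← ofReal_measureReal (measure_ne_top ν _), hν.measureReal_Ioc hb]
  congr 1; ring

/-- The truncated moment is the `q`-th exponential moment of the law over `(0, y†(n)]`. -/
theorem IsLogExpPower.truncatedMoment_eq (hν : IsLogExpPower ν ρ) {n : ℕ} (q : ℝ)
    (hn : 0 ≤ yDagger ν n) :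
    truncatedMoment ν n q = ∫ y in Ioc 0 (yDagger ν n), Real.exp (q * y) ∂ν := by
  have hmeas : Measurable fun y => ENNReal.ofReal
      (Real.exp (-tailExponent ν y) * deriv (tailExponent ν) y) :=
    ((Real.continuous_exp.comp hν.continuous_tailExponent.neg).measurable.mul
      (measurable_deriv _)).ennreal_ofReal
  have hsub : Ioc 0 (yDagger ν n) ∩ Ioi 0 = Ioc 0 (yDagger ν n) :=
    inter_eq_left.mpr fun y hy => hy.1
  rw [truncatedMoment, intervalIntegral.integral_of_le hn,
    ← congrArg ν.restrict hsub, ← Measure.restrict_restrict measurableSet_Ioc,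
    hν.restrict_Ioi_eq_withDensity, restrict_withDensity measurableSet_Ioc,
    integral_withDensity_eq_integral_toReal_smul hmeas (ae_of_all _ fun y => ENNReal.ofReal_lt_top),
    Measure.restrict_restrict measurableSet_Ioc, hsub]
  refine integral_congr_ae (ae_of_all _ fun y => ?_)
  have hnn : 0 ≤ Real.exp (-tailExponent ν y) * deriv (tailExponent ν) y :=
    mul_nonneg (Real.exp_pos _).le hν.monotone_tailExponent.deriv_nonneg
  simp only [ENNReal.toReal_ofReal hnn, smul_eq_mul, sub_eq_add_neg, Real.exp_add]
  ring

end Law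

end LogExpPower

/-! ### Levels of h and the spacing between them. -/

namespace LogExpPower

theorem tendsto_log_natCast_atTop : Tendsto (fun n : ℕ => Real.log n) atTop atTop :=
  Real.tendsto_log_atTop.comp tendsto_natCast_atTop_atTop

theorem eventually_log_le_mul {c : ℝ} (hc : 0 < c) :
    ∀ᶠ n : ℕ in atTop, Real.log (Real.log n) ≤ c * Real.log n := by
  have h := (Real.isLittleO_log_id_atTop.comp_tendsto tendsto_log_natCast_atTop).def hc
  filter_upwards [h, tendsto_log_natCast_atTop.eventually_ge_atTop 0] with n hn h0
  simp only [Function.comp_apply, id_eq, Real.norm_eq_abs, abs_of_nonneg h0] at hn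
  exact (le_abs_self _).trans hn

theorem tendsto_log_sub_two_mul_log_log :
    Tendsto (fun n : ℕ => Real.log n - 2 * Real.log (Real.log n)) atTop atTop := by
  refine tendsto_atTop_mono' _ ?_
    (tendsto_log_natCast_atTop.const_mul_atTop (show (0 : ℝ) < 1 / 2 by norm_num))
  filter_upwards [eventually_log_le_mul (show (0 : ℝ) < 1 / 4 by norm_num)] with n hn
  linarith

theorem tendsto_log_add_two_mul_log_log :
    Tendsto (fun n : ℕ => Real.log n + 2 * Real.log (Real.log n)) atTop atTop :=
  tendsto_log_natCast_atTop.atTop_add_atTop ((Real.tendsto_log_atTop.comp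
    tendsto_log_natCast_atTop).const_mul_atTop two_pos)

variable {ν : Measure ℝ} {ρ : ℝ}

theorem IsLogExpPower.exists_eventually_tailExponent_eq (hν : IsLogExpPower ν ρ) {v : ℕ → ℝ}
    (hv : Tendsto v atTop atTop) :
    ∃ y : ℕ → ℝ, (∀ n, 0 ≤ y n) ∧ ∀ᶠ n in atTop, tailExponent ν (y n) = v n := by
  have h : ∀ n, ∃ y, 0 ≤ y ∧ (tailExponent ν 0 ≤ v n → tailExponent ν y = v n) := fun n => by
    by_cases hn : tailExponent ν 0 ≤ v n
    · obtain ⟨y, hy0, hy⟩ := hν.exists_tailExponent_eq hn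
      exact ⟨y, hy0, fun _ => hy⟩
    -- Targets below h(0) get the default point 0, which keeps every level nonnegative.
    · exact ⟨0, le_rfl, fun h => absurd h hn⟩
  choose y hy0 hy using h
  exact ⟨y, hy0, (hv.eventually_ge_atTop _).mono fun n hn => hy n hn⟩

theorem IsLogExpPower.tendsto_of_tailExponent_eq (hν : IsLogExpPower ν ρ) {v y : ℕ → ℝ}
    (hv : Tendsto v atTop atTop) (hy : ∀ᶠ n in atTop, tailExponent ν (y n) = v n) :
    Tendsto y atTop atTop := by
  refine tendsto_atTop.mpr fun b => ?_
  filter_upwards [hy, hv.eventually_gt_atTop (tailExponent ν b)] with n hn hlt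
  exact (hν.monotone_tailExponent.reflect_lt (hn ▸ hlt)).le

/-- Beyond y₀ the ratio h(y)/y^s stays above its positive value at y₀; solving for y gives the
bound. -/
theorem IsLogExpPower.exists_le_const_mul_rpow (hν : IsLogExpPower ν ρ) {s : ℝ} (hs0 : 0 < s)
    (hs : s < ρ) : ∃ C y₀ : ℝ, 0 < C ∧ 0 < y₀ ∧
      ∀ y, y₀ ≤ y → y ≤ C * tailExponent ν y ^ (1 / s) := by
  obtain ⟨y₀, hy₀, hpos, hmono⟩ := hν.exists_monotoneOn_log hs
  refine ⟨Real.exp ((s * Real.log y₀ - Real.log (tailExponent ν y₀)) / s), y₀, Real.exp_pos _,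
    hy₀, fun y hy => ?_⟩
  have hy0 : 0 < y := hy₀.trans_le hy
  have hh : 0 < tailExponent ν y := hpos.trans_le (hν.monotone_tailExponent hy)
  have h := hmono (mem_Ici.mpr le_rfl) hy hy
  simp only at h
  rw [Real.rpow_def_of_pos hh, ← Real.exp_add, ← Real.log_le_iff_le_exp hy0]
  rw [mul_one_div, ← add_div, le_div_iff₀ hs0]
  linarith

/-- This is the case s = 1 of the monotonicity, available because ρ > 1. It bounds relative spacing:
(b - a)/a ≤ (h(b) - h(a))/h(a). -/
theorem IsLogExpPower.exists_div_le_div (hν : IsLogExpPower ν ρ) :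
    ∃ y₀ : ℝ, 0 < y₀ ∧ ∀ a b, y₀ ≤ a → a ≤ b →
      b * tailExponent ν a ≤ a * tailExponent ν b := by
  obtain ⟨y₀, hy₀, hpos, hmono⟩ := hν.exists_monotoneOn_log hν.one_lt
  refine ⟨y₀, hy₀, fun a b ha hab => ?_⟩
  have ha0 : 0 < a := hy₀.trans_le ha
  have hb0 : 0 < b := ha0.trans_le hab
  have hha : 0 < tailExponent ν a := hpos.trans_le (hν.monotone_tailExponent ha)
  have hhb : 0 < tailExponent ν b := hha.trans_le (hν.monotone_tailExponent hab)
  have h := hmono (show a ∈ Ici y₀ from ha) (show b ∈ Ici y₀ from ha.trans hab) hab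
  simp only at h
  rw [← Real.log_le_log_iff (by positivity) (by positivity), Real.log_mul hb0.ne' hha.ne',
    Real.log_mul ha0.ne' hhb.ne']
  linarith

/-- The points where `h = ln n ± 2 ln ln n` are so close that `e ^ (q y)` varies by a factor
`n ^ o(1)` between them. -/
theorem IsLogExpPower.tendsto_mul_sub_div_log (hν : IsLogExpPower ν ρ) {q : ℕ → ℝ}
    (hq0 : ∀ n, 0 ≤ q n) {ε : ℝ} (hε : 0 < ε)
    (hq : q =o[atTop] fun n : ℕ => Real.log (n : ℝ) ^ (2 - 1 / ρ - ε)) {a b : ℕ → ℝ}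
    (ha : ∀ᶠ n : ℕ in atTop, tailExponent ν (a n) = Real.log n - 2 * Real.log (Real.log n))
    (hb : ∀ᶠ n : ℕ in atTop, tailExponent ν (b n) = Real.log n + 2 * Real.log (Real.log n)) :
    Tendsto (fun n : ℕ => q n * (b n - a n) / Real.log n) atTop (𝓝 0) := by
  have hρ : 0 < ρ := one_pos.trans hν.one_lt
  -- Half of ε pays for taking s below ρ in the bound on a; the other half remains to absorb ln u.
  set s : ℝ := 1 / (1 / ρ + ε / 2) with hs_def
  have hs0 : 0 < s := by positivity
  have hs : s < ρ := by
    rw [hs_def, div_lt_iff₀ (by positivity)]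
    have : ρ * (1 / ρ + ε / 2) = 1 + ρ * ε / 2 := by field_simp
    rw [this]
    have := mul_pos hρ hε
    linarith
  have hs' : 1 / s = 1 / ρ + ε / 2 := by rw [hs_def, one_div_one_div]
  obtain ⟨C, y₁, hC, -, hpow⟩ := hν.exists_le_const_mul_rpow hs0 hs
  obtain ⟨y₂, hy₂, hdiv⟩ := hν.exists_div_le_div
  have hlim : Tendsto (fun n : ℕ => 8 * C * (q n / Real.log (n : ℝ) ^ (2 - 1 / ρ - ε)) *
      (Real.log (Real.log n) / Real.log n ^ (ε / 2))) atTop (𝓝 0) := by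
    have h1 := hq.tendsto_div_nhds_zero
    have h2 := (isLittleO_log_rpow_atTop (half_pos hε)).tendsto_div_nhds_zero.comp
      tendsto_log_natCast_atTop
    simpa using (h1.const_mul (8 * C)).mul h2
  refine squeeze_zero' ?_ ?_ hlim
  · filter_upwards [ha, hb, tendsto_log_natCast_atTop.eventually_gt_atTop 1] with n han hbn hu
    have hl := Real.log_pos hu
    have : a n < b n := hν.monotone_tailExponent.reflect_lt (by rw [han, hbn]; linarith)
    have := hq0 n
    exact div_nonneg (mul_nonneg this (by linarith)) (by linarith)
  · have hatop := hν.tendsto_of_tailExponent_eq tendsto_log_sub_two_mul_log_log ha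
    filter_upwards [ha, hb, tendsto_log_natCast_atTop.eventually_gt_atTop 1,
      eventually_log_le_mul (show (0 : ℝ) < 1 / 4 by norm_num),
      hatop.eventually_ge_atTop y₁, hatop.eventually_ge_atTop y₂]
      with n han hbn hu hlu h₁ h₂
    set u := Real.log n
    have hl := Real.log_pos hu
    have hu0 : 0 < u := by linarith
    have hab : a n < b n := hν.monotone_tailExponent.reflect_lt (by rw [han, hbn]; linarith)
    have hA := hpow _ h₁
    have hB := hdiv _ _ h₂ hab.le
    rw [han] at hA hB
    rw [hbn] at hB
    have hA' : a n ≤ C * u ^ (1 / s) := hA.trans (mul_le_mul_of_nonneg_left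
      (Real.rpow_le_rpow (by linarith) (by linarith) (by positivity)) hC.le)
    have ha0 : 0 < a n := hy₂.trans_le h₂
    -- Here h(b) - h(a) = 4 ln u, and h(a) = u - 2 ln u ≥ u/2 since ln u ≤ u/4; this makes the
    -- factor 8.
    have hgap : b n - a n ≤ 8 * a n * Real.log u / u := by
      rw [le_div_iff₀ hu0]
      nlinarith
    have hgap' : b n - a n ≤ 8 * (C * u ^ (1 / s)) * Real.log u / u := hgap.trans (by gcongr)
    calc q n * (b n - a n) / u ≤ q n * (8 * (C * u ^ (1 / s)) * Real.log u / u) / u := by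
          have := hq0 n
          gcongr
      _ = 8 * C * (q n / u ^ (2 - 1 / ρ - ε)) * (Real.log u / u ^ (ε / 2)) := by
          have hexp : 1 / s = 2 - (2 - 1 / ρ - ε) - ε / 2 := by rw [hs']; ring
          rw [hexp, Real.rpow_sub hu0, Real.rpow_sub hu0, Real.rpow_two]
          have h1 := (Real.rpow_pos_of_pos hu0 (2 - 1 / ρ - ε)).ne'
          have h2 := (Real.rpow_pos_of_pos hu0 (ε / 2)).ne'
          field_simp

end LogExpPower

/-! ### Almost sure bounds for sums and maxima. -/

namespace LogExpPower

section AlmostSure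

variable {Ω : Type*} [MeasurableSpace Ω] {μ : Measure Ω} [IsProbabilityMeasure μ]
  {Y : ℕ → Ω → ℝ} {ρ : ℝ}

theorem exp_neg_two_mul_log {n : ℕ} (hn : 0 < n) :
    Real.exp (-(2 * Real.log n)) = 1 / (n : ℝ) ^ 2 := by
  have hn' : (0 : ℝ) < n := by exact_mod_cast hn
  rw [Real.exp_neg, mul_comm, Real.exp_mul, Real.exp_log hn', Real.rpow_two, one_div]

theorem ae_eventually_sum_lt (hmeas : ∀ k, Measurable (Y k)) (hindep : iIndepFun Y μ)
    (hident : ∀ k, IdentDistrib (Y k) (Y 0) μ μ) {f : ℕ → ℝ → ℝ} (hf : ∀ n, Measurable (f n))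
    (h0 : ∀ n x, 0 ≤ f n x) (h1 : ∀ n x, f n x ≤ 1) :
    ∀ᵐ ω ∂μ, ∀ᶠ n : ℕ in atTop, ∑ k ∈ Finset.range n, f n (Y k ω) <
      2 * (n * ∫ x, f n x ∂(μ.map (Y 0))) + 2 * Real.log n := by
  have hs := (Real.summable_one_div_nat_pow (p := 2)).mpr (by norm_num)
  have h := ae_eventually_notMem_of_summable (μ := μ) hs <| (eventually_gt_atTop 0).mono
    fun n hn => (measureReal_sum_ge_le hmeas hindep hident (hf n) (h0 n) (h1 n) n
      (2 * Real.log n)).trans_eq (exp_neg_two_mul_log hn)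
  filter_upwards [h] with ω hω
  filter_upwards [hω] with n hn
  exact not_le.mp hn

theorem ae_eventually_lt_sum (hmeas : ∀ k, Measurable (Y k)) (hindep : iIndepFun Y μ)
    (hident : ∀ k, IdentDistrib (Y k) (Y 0) μ μ) {f : ℕ → ℝ → ℝ} (hf : ∀ n, Measurable (f n))
    (h0 : ∀ n x, 0 ≤ f n x) (h1 : ∀ n x, f n x ≤ 1) :
    ∀ᵐ ω ∂μ, ∀ᶠ n : ℕ in atTop, 20 * Real.log n ≤ n * ∫ x, f n x ∂(μ.map (Y 0)) →
      (n * ∫ x, f n x ∂(μ.map (Y 0))) / 2 < ∑ k ∈ Finset.range n, f n (Y k ω) := by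
  have hs := (Real.summable_one_div_nat_pow (p := 2)).mpr (by norm_num)
  -- The threshold belongs to the event: where it fails the event is empty, and where it holds
  -- e^{-m/10} ≤ n⁻² for m ≥ 20 ln n.
  have h := ae_eventually_notMem_of_summable (μ := μ) (s := fun n : ℕ =>
    {ω | 20 * Real.log n ≤ n * ∫ x, f n x ∂(μ.map (Y 0)) ∧
      ∑ k ∈ Finset.range n, f n (Y k ω) ≤ (n * ∫ x, f n x ∂(μ.map (Y 0))) / 2}) hs <|
    (eventually_gt_atTop 0).mono fun n hn => by
      by_cases hm : 20 * Real.log n ≤ n * ∫ x, f n x ∂(μ.map (Y 0))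
      · simp only [hm, true_and]
        refine (measureReal_sum_le_le hmeas hindep hident (hf n) (h0 n) (h1 n) n).trans ?_
        rw [← exp_neg_two_mul_log hn]
        exact Real.exp_le_exp.mpr (by linarith)
      · simp only [hm, false_and, ofPred_false, measureReal_empty]
        positivity
  filter_upwards [h] with ω hω
  filter_upwards [hω] with n hn hm
  exact not_le.mp fun hle => hn ⟨hm, hle⟩

/-- Almost surely, the maximum of `Y_0, …, Y_{n-1}` eventually exceeds any level with
`h = ln n - 2 ln ln n`. -/
theorem ae_eventually_exists_gt (hmeas : ∀ k, Measurable (Y k)) (hindep : iIndepFun Y μ)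
    (hident : ∀ k, IdentDistrib (Y k) (Y 0) μ μ) (hν : IsLogExpPower (μ.map (Y 0)) ρ)
    {a : ℕ → ℝ} (ha : ∀ᶠ n : ℕ in atTop,
      tailExponent (μ.map (Y 0)) (a n) = Real.log n - 2 * Real.log (Real.log n)) :
    ∀ᵐ ω ∂μ, ∀ᶠ n : ℕ in atTop, ∃ k ∈ Finset.range n, a n < Y k ω := by
  have : IsProbabilityMeasure (μ.map (Y 0)) := Measure.isProbabilityMeasure_map (hmeas 0).aemeasurable
  have h := ae_eventually_lt_sum hmeas hindep hident
    (f := fun n => (Ioi (a n)).indicator fun _ => (1 : ℝ))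
    (fun n => measurable_const.indicator measurableSet_Ioi)
    (fun n x => indicator_nonneg (fun _ _ => zero_le_one) x)
    (fun n x => indicator_apply_le' (fun _ => le_rfl) fun _ => zero_le_one)
  filter_upwards [h] with ω hω
  filter_upwards [hω, ha, tendsto_log_natCast_atTop.eventually_gt_atTop 20, eventually_gt_atTop 0]
    with n hn han hu hn0
  have hn' : (0 : ℝ) < n := by exact_mod_cast hn0
  -- The expected number of exceedances of a is ln² n, above the threshold 20 ln n once ln n > 20.
  have hint : (n : ℝ) * ∫ x, (Ioi (a n)).indicator (fun _ => (1 : ℝ)) x ∂(μ.map (Y 0))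
      = Real.log n ^ 2 := by
    have hu0 : 0 < Real.log n := by linarith
    rw [integral_indicator_const _ measurableSet_Ioi, hν.measureReal_Ioi, han, neg_sub,
      Real.exp_sub, Real.exp_log hn', mul_comm 2, Real.exp_mul, Real.exp_log hu0, Real.rpow_two]
    simp only [smul_eq_mul, mul_one]
    field_simp
  rw [hint] at hn
  have hpos := hn (by nlinarith)
  by_contra! hcon
  have hz : ∑ k ∈ Finset.range n, (Ioi (a n)).indicator (fun _ => (1 : ℝ)) (Y k ω) = 0 :=
    Finset.sum_eq_zero fun k hk => indicator_of_notMem (not_lt.mpr (hcon k hk)) _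
  rw [hz] at hpos
  nlinarith [sq_nonneg (Real.log n)]

/-- Almost surely, the maximum of `Y_0, …, Y_{n-1}` is eventually at most any level with
`h = ln n + 2 ln ln n`. -/
theorem ae_eventually_forall_le (hmeas : ∀ k, Measurable (Y k))
    (hident : ∀ k, IdentDistrib (Y k) (Y 0) μ μ) (hν : IsLogExpPower (μ.map (Y 0)) ρ)
    {b : ℕ → ℝ} (hb : ∀ᶠ n : ℕ in atTop,
      tailExponent (μ.map (Y 0)) (b n) = Real.log n + 2 * Real.log (Real.log n)) :
    ∀ᵐ ω ∂μ, ∀ᶠ n : ℕ in atTop, ∀ k ∈ Finset.range n, Y k ω ≤ b n := by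
  have : IsProbabilityMeasure (μ.map (Y 0)) := Measure.isProbabilityMeasure_map (hmeas 0).aemeasurable
  have hbtop := hν.tendsto_of_tailExponent_eq tendsto_log_add_two_mul_log_log hb
  -- Only the single variable Y_n is tested against b_n, with summable probability 1/(n ln² n). A
  -- union bound over the first n variables would give 1/ln² n, which is not summable.
  have h := ae_eventually_notMem_of_summable (μ := μ) (s := fun n => {ω | b n < Y n ω})
    summable_one_div_mul_log_sq <| by
      filter_upwards [hb, tendsto_log_natCast_atTop.eventually_gt_atTop 0, eventually_gt_atTop 0]
        with n hbn hu hn0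
      have hn' : (0 : ℝ) < n := by exact_mod_cast hn0
      have : μ.real {ω | b n < Y n ω} = (μ.map (Y 0)).real (Ioi (b n)) := by
        rw [← (hident n).map_eq, map_measureReal_apply (hmeas n) measurableSet_Ioi]
        rfl
      rw [this, hν.measureReal_Ioi, hbn, Real.exp_neg, Real.exp_add, Real.exp_log hn', mul_comm 2,
        Real.exp_mul, Real.exp_log hu, Real.rpow_two, one_div]
  filter_upwards [h] with ω hω
  obtain ⟨N, hN⟩ := eventually_atTop.mp ((hω.and hb).and
    (tendsto_log_natCast_atTop.eventually_gt_atTop 0))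
  -- The finitely many early variables are overtaken because b tends to infinity; each later one
  -- satisfies Y_k ≤ b_k ≤ b_n.
  have hfin : ∀ᶠ n in atTop, ∀ k ∈ Finset.range N, Y k ω ≤ b n :=
    (Finset.eventually_all _).mpr fun k _ => hbtop.eventually_ge_atTop _
  filter_upwards [hfin, eventually_ge_atTop N] with n hn hNn k hk
  rcases lt_or_ge k N with hkN | hkN
  · exact hn k (Finset.mem_range.mpr hkN)
  · obtain ⟨⟨hk1, hk2⟩, hk3⟩ := hN k hkN
    have hn2 := (hN n hNn).1.2
    have hkn : k < n := Finset.mem_range.mp hk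
    have hk0 : (0 : ℝ) < k := by
      by_contra hcon
      have : (k : ℝ) = 0 := le_antisymm (not_lt.mp hcon) k.cast_nonneg
      simp [this] at hk3
    have hlog : Real.log k < Real.log n := Real.log_lt_log hk0 (by exact_mod_cast hkn)
    have hloglog := Real.log_lt_log hk3 hlog
    exact (not_lt.mp hk1).trans
      (hν.monotone_tailExponent.reflect_lt (by rw [hk2, hn2]; linarith)).le

end AlmostSure

/-! ### Splitting exponential integrals and normalising the integrand. -/

section Comparison

variable {ν : Measure ℝ} [IsProbabilityMeasure ν] {q : ℝ}

theorem integrableOn_exp_mul_Iic (hq : 0 ≤ q) (b : ℝ) :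
    IntegrableOn (fun x => Real.exp (q * x)) (Iic b) ν := by
  refine Integrable.of_bound (C := Real.exp (q * b)) (by fun_prop) ?_
  filter_upwards [ae_restrict_mem measurableSet_Iic] with x hx
  rw [Real.norm_of_nonneg (Real.exp_pos _).le]
  exact Real.exp_le_exp.mpr (mul_le_mul_of_nonneg_left hx hq)

theorem setIntegral_exp_mul_le (hq : 0 ≤ q) {b : ℝ} {s t : Set ℝ} (hs : s ⊆ Iic b)
    (hst : s ⊆ t) :
    ∫ x in s, Real.exp (q * x) ∂ν ≤ Real.exp (q * b) * ν.real t := by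
  have h := norm_setIntegral_le_of_norm_le_const (μ := ν) (s := s) (C := Real.exp (q * b))
    (f := fun x => Real.exp (q * x)) (measure_lt_top _ _) fun x hx => by
      rw [Real.norm_of_nonneg (Real.exp_pos _).le]
      exact Real.exp_le_exp.mpr (mul_le_mul_of_nonneg_left (hs hx) hq)
  exact ((Real.le_norm_self _).trans h).trans
    (mul_le_mul_of_nonneg_left (measureReal_mono hst) (Real.exp_pos _).le)

/-- Split at 0 and d: the integrand is at most 1 on the negative axis and at most e^{qb} on (d, b].
-/
theorem setIntegral_exp_mul_Iic_le (hq : 0 ≤ q) {b d : ℝ} (hd : 0 ≤ d) (hdb : d ≤ b) :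
    ∫ x in Iic b, Real.exp (q * x) ∂ν ≤
      1 + ∫ x in Ioc 0 d, Real.exp (q * x) ∂ν + Real.exp (q * b) * ν.real (Ioi d) := by
  have hi := integrableOn_exp_mul_Iic (ν := ν) hq b
  rw [← Iic_union_Ioc_eq_Iic hdb, setIntegral_union (Iic_disjoint_Ioc le_rfl) measurableSet_Ioc
    (hi.mono_set (Iic_subset_Iic.mpr hdb)) (hi.mono_set Ioc_subset_Iic_self),
    ← Iic_union_Ioc_eq_Iic hd, setIntegral_union (Iic_disjoint_Ioc le_rfl) measurableSet_Ioc
    (hi.mono_set (Iic_subset_Iic.mpr (hd.trans hdb)))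
    (hi.mono_set (Ioc_subset_Iic_self.trans (Iic_subset_Iic.mpr hdb)))]
  have h1 : ∫ x in Iic 0, Real.exp (q * x) ∂ν ≤ 1 := by
    simpa using setIntegral_exp_mul_le (ν := ν) hq subset_rfl (subset_univ (Iic (0 : ℝ)))
  have h2 := setIntegral_exp_mul_le (ν := ν) hq (Ioc_subset_Iic_self (a := d) (b := b))
    Ioc_subset_Ioi_self
  linarith

theorem setIntegral_exp_mul_Ioc_le (hq : 0 ≤ q) {a d : ℝ} (ha : 0 ≤ a) (had : a ≤ d) :
    ∫ x in Ioc 0 d, Real.exp (q * x) ∂ν ≤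
      ∫ x in Ioc 0 a, Real.exp (q * x) ∂ν + Real.exp (q * d) * ν.real (Ioi a) := by
  have hi := (integrableOn_exp_mul_Iic (ν := ν) hq d)
  rw [← Ioc_union_Ioc_eq_Ioc ha had, setIntegral_union
    (Ioc_disjoint_Ioc_of_le le_rfl) measurableSet_Ioc
    (hi.mono_set (Ioc_subset_Iic_self.trans (Iic_subset_Iic.mpr had)))
    (hi.mono_set Ioc_subset_Iic_self)]
  have h2 := setIntegral_exp_mul_le (ν := ν) hq (Ioc_subset_Iic_self (a := a) (b := d))
    Ioc_subset_Ioi_self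
  linarith

theorem exp_mul_measureReal_Ioc_le (hq : 0 ≤ q) {a d : ℝ} (ha : 0 ≤ a) :
    Real.exp (q * a) * ν.real (Ioc a d) ≤ ∫ x in Ioc 0 d, Real.exp (q * x) ∂ν := by
  have hi := (integrableOn_exp_mul_Iic (ν := ν) hq d).mono_set
    (Ioc_subset_Iic_self (a := 0))
  refine le_trans ?_ (setIntegral_mono_set hi (ae_of_all _ fun x => (Real.exp_pos _).le)
    (Ioc_subset_Ioc_left ha).eventuallyLE)
  refine setIntegral_ge_of_const_le_real measurableSet_Ioc (measure_ne_top _ _) (fun x hx => ?_)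
    (hi.mono_set (Ioc_subset_Ioc_left ha))
  exact Real.exp_le_exp.mpr (mul_le_mul_of_nonneg_left hx.1.le hq)

/-- The function `e ^ (q (x - c))` truncated to a set `s`. -/
noncomputable def tiltedIndicator (q c : ℝ) (s : Set ℝ) : ℝ → ℝ :=
  s.indicator fun x => Real.exp (q * (x - c))

theorem measurable_tiltedIndicator (c : ℝ) {s : Set ℝ} (hs : MeasurableSet s) :
    Measurable (tiltedIndicator q c s) :=
  Measurable.indicator (by fun_prop) hs

theorem tiltedIndicator_nonneg (c : ℝ) (s : Set ℝ) (x : ℝ) : 0 ≤ tiltedIndicator q c s x :=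
  indicator_nonneg (fun _ _ => (Real.exp_pos _).le) x

/-- This normalisation is what makes the Chernoff bounds uniform in q. -/
theorem tiltedIndicator_le_one (hq : 0 ≤ q) {c : ℝ} {s : Set ℝ} (hs : s ⊆ Iic c) (x : ℝ) :
    tiltedIndicator q c s x ≤ 1 :=
  indicator_apply_le' (fun hx => Real.exp_le_one_iff.mpr
    (mul_nonpos_of_nonneg_of_nonpos hq (sub_nonpos.mpr (hs hx)))) fun _ => zero_le_one

theorem exp_mul_mul_tiltedIndicator_le (c : ℝ) (s : Set ℝ) (x : ℝ) :
    Real.exp (q * c) * tiltedIndicator q c s x ≤ Real.exp (q * x) := by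
  by_cases hx : x ∈ s
  · rw [tiltedIndicator, indicator_of_mem hx, ← Real.exp_add]
    exact Real.exp_le_exp.mpr (by linarith)
  · rw [tiltedIndicator, indicator_of_notMem hx, mul_zero]
    exact (Real.exp_pos _).le

theorem exp_mul_mul_tiltedIndicator_eq (c : ℝ) {s : Set ℝ} {x : ℝ} (hx : x ∈ s) :
    Real.exp (q * c) * tiltedIndicator q c s x = Real.exp (q * x) := by
  rw [tiltedIndicator, indicator_of_mem hx, ← Real.exp_add]
  congr 1; ring

end Comparison

theorem exp_mul_mul_integral_tiltedIndicator (ν : Measure ℝ) (q c : ℝ) {s : Set ℝ} (hs : MeasurableSet s) :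
    Real.exp (q * c) * ∫ x, tiltedIndicator q c s x ∂ν = ∫ x in s, Real.exp (q * x) ∂ν := by
  rw [tiltedIndicator, integral_indicator hs, ← integral_const_mul]
  refine integral_congr_ae (ae_of_all _ fun x => ?_)
  simp only [← Real.exp_add]
  congr 1; ring

end LogExpPower

/-! ### Two-sided comparison of the sample moment with the truncated moment. -/

namespace LogExpPower

theorem abs_log_sub_log_le {x y K : ℝ} (hx : 0 < x) (hy : 0 < y) (hK : 0 < K)
    (hxy : x ≤ K * y) (hyx : y ≤ K * x) : |Real.log x - Real.log y| ≤ Real.log K := by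
  have h1 := Real.log_le_log hx hxy
  have h2 := Real.log_le_log hy hyx
  rw [Real.log_mul hK.ne' hy.ne'] at h1
  rw [Real.log_mul hK.ne' hx.ne'] at h2
  exact abs_le.mpr ⟨by linarith, by linarith⟩

theorem sampleMoment_exp {Ω : Type*} (Y : ℕ → Ω → ℝ) (n : ℕ) (q : ℝ) (ω : Ω) :
    sampleMoment (fun k ω => Real.exp (Y k ω)) n q ω
      = (∑ k ∈ Finset.range n, Real.exp (q * Y k ω)) / n := by
  simp only [sampleMoment, ← Real.exp_mul, one_div, inv_mul_eq_div, mul_comm q]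

section Deterministic

variable {ν : Measure ℝ} [IsProbabilityMeasure ν] {q a b d u c : ℝ} {n : ℕ} {y : ℕ → ℝ}

/-- Upper comparison of the empirical mean of `e ^ (q y)` with the truncated integral. -/
theorem empirical_le_mul_setIntegral (hq : 0 ≤ q) (hn : 0 < n) (ha : 0 ≤ a) (had : a ≤ d)
    (hdb : d ≤ b) (hu : 1 ≤ u) (hc : 0 < c) (hcd : c ≤ ν.real (Ioc 0 d))
    (hadn : 1 / (n : ℝ) ≤ ν.real (Ioc a d)) (hd : ν.real (Ioi d) ≤ 1 / n)
    (hle : ∀ k ∈ Finset.range n, y k ≤ b)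
    (hsum : ∑ k ∈ Finset.range n, tiltedIndicator q b (Iic b) (y k) ≤
      2 * (n * ∫ x, tiltedIndicator q b (Iic b) x ∂ν) + 2 * u) :
    (∑ k ∈ Finset.range n, Real.exp (q * y k)) / n ≤
      (2 / c + 23) * u ^ 2 * Real.exp (q * (b - a)) * ∫ x in Ioc 0 d, Real.exp (q * x) ∂ν := by
  have hn' : (0 : ℝ) < n := by exact_mod_cast hn
  set M := ∫ x in Ioc 0 d, Real.exp (q * x) ∂ν with hM
  set D := Real.exp (q * (b - a)) with hD
  have hD1 : 1 ≤ D := Real.one_le_exp (mul_nonneg hq (by linarith))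
  have hcM : c ≤ M := hcd.trans (by simpa using exp_mul_measureReal_Ioc_le (ν := ν) (d := d) hq le_rfl)
  have hM0 : 0 < M := hc.trans_le hcM
  -- The interval (a, d] has mass at least 1/n and e^{qx} ≥ e^{qa} on it, so M ≥ e^{qa}/n.
  have hbD : Real.exp (q * b) / n ≤ D * M := by
    have h1 : Real.exp (q * b) = D * Real.exp (q * a) := by
      rw [hD, ← Real.exp_add]; congr 1; ring
    rw [h1, mul_div_assoc]
    refine mul_le_mul_of_nonneg_left (le_trans ?_ (exp_mul_measureReal_Ioc_le hq ha)) (by positivity)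
    rw [div_eq_mul_one_div]
    exact mul_le_mul_of_nonneg_left hadn (Real.exp_pos _).le
  have hI := setIntegral_exp_mul_Iic_le (ν := ν) hq (ha.trans had) hdb
  rw [← hM] at hI
  have hIoi : Real.exp (q * b) * ν.real (Ioi d) ≤ D * M := by
    refine le_trans ?_ hbD
    rw [div_eq_mul_one_div]
    exact mul_le_mul_of_nonneg_left hd (Real.exp_pos _).le
  have hS : (∑ k ∈ Finset.range n, Real.exp (q * y k)) / n ≤
      2 * (∫ x in Iic b, Real.exp (q * x) ∂ν) + 2 * u * (Real.exp (q * b) / n) := by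
    rw [div_le_iff₀ hn', ← exp_mul_mul_integral_tiltedIndicator ν q b measurableSet_Iic]
    calc ∑ k ∈ Finset.range n, Real.exp (q * y k)
        = Real.exp (q * b) * ∑ k ∈ Finset.range n, tiltedIndicator q b (Iic b) (y k) := by
          rw [Finset.mul_sum]
          exact Finset.sum_congr rfl fun k hk =>
            (exp_mul_mul_tiltedIndicator_eq b (mem_Iic.mpr (hle k hk))).symm
      _ ≤ _ := mul_le_mul_of_nonneg_left hsum (Real.exp_pos _).le
      _ = _ := by field_simp
  have h1 : 1 ≤ M / c := (one_le_div hc).mpr hcM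
  have huD : 1 ≤ u ^ 2 * D := one_le_mul_of_one_le_of_one_le (one_le_pow₀ hu) hD1
  have hMD : M ≤ u ^ 2 * D * M := le_mul_of_one_le_left hM0.le huD
  have hMc : M / c ≤ u ^ 2 * D * (M / c) := le_mul_of_one_le_left (by positivity) huD
  have hDM : D * M ≤ u ^ 2 * D * M := by
    rw [mul_assoc]; exact le_mul_of_one_le_left (by positivity) (one_le_pow₀ hu)
  have huDM : u * (D * M) ≤ u ^ 2 * D * M := by
    rw [mul_assoc]; exact mul_le_mul_of_nonneg_right (by nlinarith) (by positivity)
  have hub : u * (Real.exp (q * b) / n) ≤ u * (D * M) :=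
    mul_le_mul_of_nonneg_left hbD (by linarith)
  -- The 2/c pays for the negative axis through 1 ≤ M/c. The remaining terms need only 6; the value
  -- 23 = 2 + 20 + 1 is forced by the lower comparison, which shares the constant.
  have hrw : (2 / c + 23) * u ^ 2 * D * M = 2 * (u ^ 2 * D * (M / c)) + 23 * (u ^ 2 * D * M) := by
    field_simp
  rw [hrw]
  linarith

/-- Lower comparison of the empirical mean of `e ^ (q y)` with the truncated integral. -/
theorem setIntegral_le_mul_empirical (hq : 0 ≤ q) (hn : 0 < n) (ha : 0 ≤ a) (had : a ≤ d)
    (hdb : d ≤ b) (hu : 1 ≤ u) (hc : 0 < c) (haIoi : ν.real (Ioi a) ≤ u ^ 2 / n)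
    (hgt : ∃ k ∈ Finset.range n, a < y k)
    (hsum : 20 * u ≤ n * ∫ x, tiltedIndicator q a (Ioc 0 a) x ∂ν →
      (n * ∫ x, tiltedIndicator q a (Ioc 0 a) x ∂ν) / 2 <
        ∑ k ∈ Finset.range n, tiltedIndicator q a (Ioc 0 a) (y k)) :
    ∫ x in Ioc 0 d, Real.exp (q * x) ∂ν ≤ (2 / c + 23) * u ^ 2 * Real.exp (q * (b - a)) *
      ((∑ k ∈ Finset.range n, Real.exp (q * y k)) / n) := by
  have hn' : (0 : ℝ) < n := by exact_mod_cast hn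
  set S := (∑ k ∈ Finset.range n, Real.exp (q * y k)) / n with hS
  set D := Real.exp (q * (b - a)) with hD
  set m := ∫ x, tiltedIndicator q a (Ioc 0 a) x ∂ν
  have hD1 : 1 ≤ D := Real.one_le_exp (mul_nonneg hq (by linarith))
  -- One observation above a already contributes this much to the sum.
  have haS : Real.exp (q * a) / n ≤ S := by
    obtain ⟨k, hk, hak⟩ := hgt
    refine div_le_div_of_nonneg_right ?_ hn'.le
    exact (Real.exp_le_exp.mpr (mul_le_mul_of_nonneg_left hak.le hq)).trans
      (Finset.single_le_sum (f := fun k => Real.exp (q * y k)) (fun k _ => (Real.exp_pos _).le) hk)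
  have hS0 : 0 < S := lt_of_lt_of_le (by positivity) haS
  have hsplit := setIntegral_exp_mul_Ioc_le (ν := ν) hq ha had
  have hfirst : ∫ x in Ioc 0 a, Real.exp (q * x) ∂ν ≤ 2 * S + 20 * u * S := by
    rw [← exp_mul_mul_integral_tiltedIndicator ν q a measurableSet_Ioc]
    change Real.exp (q * a) * m ≤ _
    -- If the mean is large, the lower Chernoff bound compares it with the sum. If it is small, the
    -- integral is at most 20 u e^{qa}/n, which the observation above a controls.
    by_cases hm : 20 * u ≤ n * m
    · have h1 : Real.exp (q * a) *
          ∑ k ∈ Finset.range n, tiltedIndicator q a (Ioc 0 a) (y k) ≤ n * S := by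
        rw [hS, mul_div_cancel₀ _ hn'.ne', Finset.mul_sum]
        exact Finset.sum_le_sum fun k _ => exp_mul_mul_tiltedIndicator_le a _ _
      have h2 := mul_le_mul_of_nonneg_left (hsum hm).le (Real.exp_pos (q * a)).le
      have h3 : n * (Real.exp (q * a) * m) ≤ n * (2 * S) := by linarith
      have h4 : 0 ≤ 20 * u * S := by positivity
      linarith [le_of_mul_le_mul_left h3 hn']
    · have h1 : m ≤ 20 * u / n := by rw [le_div_iff₀ hn']; linarith
      have h2 : Real.exp (q * a) * m ≤ 20 * u * (Real.exp (q * a) / n) :=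
        (mul_le_mul_of_nonneg_left h1 (Real.exp_pos _).le).trans_eq (by ring)
      have h3 : 20 * u * (Real.exp (q * a) / n) ≤ 20 * u * S :=
        mul_le_mul_of_nonneg_left haS (by positivity)
      linarith
  have hsecond : Real.exp (q * d) * ν.real (Ioi a) ≤ u ^ 2 * D * S := by
    have h1 : Real.exp (q * d) ≤ D * Real.exp (q * a) := by
      rw [hD, ← Real.exp_add]
      exact Real.exp_le_exp.mpr (by nlinarith)
    calc Real.exp (q * d) * ν.real (Ioi a) ≤ (D * Real.exp (q * a)) * (u ^ 2 / n) :=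
          mul_le_mul h1 haIoi measureReal_nonneg (by positivity)
      _ = u ^ 2 * D * (Real.exp (q * a) / n) := by ring
      _ ≤ _ := mul_le_mul_of_nonneg_left haS (by positivity)
  have huD : 1 ≤ u ^ 2 * D := one_le_mul_of_one_le_of_one_le (one_le_pow₀ hu) hD1
  have huuD : u ≤ u ^ 2 * D := (show u ≤ u ^ 2 by nlinarith).trans
    (le_mul_of_one_le_right (by positivity) hD1)
  have h1 : S ≤ u ^ 2 * D * S := le_mul_of_one_le_left hS0.le huD
  have h2 : u * S ≤ u ^ 2 * D * S := mul_le_mul_of_nonneg_right huuD hS0.le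
  have h3 : 0 ≤ 2 / c * (u ^ 2 * D * S) := by positivity
  have hrw : (2 / c + 23) * u ^ 2 * D * S = 2 / c * (u ^ 2 * D * S) + 23 * (u ^ 2 * D * S) := by
    ring
  rw [hrw]
  linarith

end Deterministic

/-- The mass of (0, d] is e^{-h(0)} - 1/n, so at least half of P(Y > 0) once n is large. Since
e^{qy} ≥ 1 there, this bounds the truncated moment below uniformly in q. -/
theorem IsLogExpPower.eventually_yDagger {ν : Measure ℝ} {ρ : ℝ} [IsProbabilityMeasure ν]
    (hν : IsLogExpPower ν ρ) : ∀ᶠ n in atTop, 0 ≤ yDagger ν n ∧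
      Real.exp (-tailExponent ν 0) / 2 ≤ ν.real (Ioc 0 (yDagger ν n)) := by
  filter_upwards [eventually_ge_atTop 2, tendsto_log_natCast_atTop.eventually_gt_atTop
    (tailExponent ν 0 + Real.log 2)] with n hn hu
  have hd := tailExponent_yDagger hν hn
  have hlog := Real.log_pos one_lt_two
  have h0 : 0 ≤ yDagger ν n := (hν.monotone_tailExponent.reflect_lt (by rw [hd]; linarith)).le
  refine ⟨h0, ?_⟩
  rw [hν.measureReal_Ioc h0, hd]
  have h1 : Real.exp (-Real.log n) ≤ Real.exp (-tailExponent ν 0 - Real.log 2) :=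
    Real.exp_le_exp.mpr (by linarith)
  rw [Real.exp_sub, Real.exp_log two_pos] at h1
  linarith

theorem IsLogExpPower.eventually_truncatedMoment_pos {ν : Measure ℝ} {ρ : ℝ}
    [IsProbabilityMeasure ν] (hν : IsLogExpPower ν ρ) {q : ℕ → ℝ} (hq : ∀ n, 0 ≤ q n) :
    ∀ᶠ n in atTop, 0 < truncatedMoment ν n (q n) := by
  filter_upwards [hν.eventually_yDagger] with n hn
  rw [hν.truncatedMoment_eq _ hn.1]
  have h := exp_mul_measureReal_Ioc_le (ν := ν) (d := yDagger ν n) (hq n) le_rfl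
  rw [mul_zero, Real.exp_zero, one_mul] at h
  exact lt_of_lt_of_le (by positivity) (hn.2.trans h)

/-- The two comparisons give |ln S - ln M_T| ≤ ln K + 2 ln u + q(b - a), and every term is o(u). -/
theorem ae_tendsto_log_sampleMoment_sub {Ω : Type*} [MeasurableSpace Ω] {μ : Measure Ω}
    [IsProbabilityMeasure μ] {ρ : ℝ} {Y : ℕ → Ω → ℝ} (hmeas : ∀ k, Measurable (Y k))
    (hindep : iIndepFun Y μ) (hident : ∀ k, IdentDistrib (Y k) (Y 0) μ μ)
    (hν : IsLogExpPower (μ.map (Y 0)) ρ) {q : ℕ → ℝ} (hq0 : ∀ n, 0 ≤ q n) {ε : ℝ} (hε : 0 < ε)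
    (hq : q =o[atTop] fun n : ℕ => Real.log (n : ℝ) ^ (2 - 1 / ρ - ε)) :
    ∀ᵐ ω ∂μ, Tendsto (fun n : ℕ =>
        Real.log (sampleMoment (fun k ω => Real.exp (Y k ω)) n (q n) ω) / Real.log (n : ℝ)
          - Real.log (truncatedMoment (μ.map (Y 0)) n (q n)) / Real.log (n : ℝ))
      atTop (𝓝 0) := by
  have : IsProbabilityMeasure (μ.map (Y 0)) := Measure.isProbabilityMeasure_map (hmeas 0).aemeasurable
  set ν := μ.map (Y 0) with hνdef
  obtain ⟨a, ha0, ha⟩ := hν.exists_eventually_tailExponent_eq tendsto_log_sub_two_mul_log_log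
  obtain ⟨b, -, hb⟩ := hν.exists_eventually_tailExponent_eq tendsto_log_add_two_mul_log_log
  have hgap := hν.tendsto_mul_sub_div_log hq0 hε hq ha hb
  set c : ℝ := Real.exp (-tailExponent ν 0) / 2 with hcdef
  have hc : 0 < c := by positivity
  have hlim : Tendsto (fun n : ℕ => Real.log (2 / c + 23) / Real.log n
      + 2 * (Real.log (Real.log n) / Real.log n) + q n * (b n - a n) / Real.log n)
      atTop (𝓝 0) := by
    have h1 := tendsto_log_natCast_atTop.const_div_atTop (Real.log (2 / c + 23))
    have h2 : Tendsto (fun n : ℕ => Real.log (Real.log n) / Real.log n) atTop (𝓝 0) :=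
      Real.isLittleO_log_id_atTop.tendsto_div_nhds_zero.comp tendsto_log_natCast_atTop
    simpa using (h1.add (h2.const_mul 2)).add hgap
  filter_upwards [ae_eventually_exists_gt hmeas hindep hident hν ha,
    ae_eventually_forall_le hmeas hident hν hb,
    ae_eventually_sum_lt hmeas hindep hident
      (f := fun n => tiltedIndicator (q n) (b n) (Iic (b n)))
      (fun n => measurable_tiltedIndicator _ measurableSet_Iic)
      (fun n => tiltedIndicator_nonneg _ _) (fun n => tiltedIndicator_le_one (hq0 n) subset_rfl),
    ae_eventually_lt_sum hmeas hindep hident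
      (f := fun n => tiltedIndicator (q n) (a n) (Ioc 0 (a n)))
      (fun n => measurable_tiltedIndicator _ measurableSet_Ioc)
      (fun n => tiltedIndicator_nonneg _ _)
      (fun n => tiltedIndicator_le_one (hq0 n) Ioc_subset_Iic_self)] with ω h1 h2 h3 h4
  refine squeeze_zero_norm' ?_ hlim
  filter_upwards [h1, h2, h3, h4, ha, hb, hν.eventually_yDagger,
    hν.eventually_truncatedMoment_pos hq0, eventually_ge_atTop 2,
    tendsto_log_natCast_atTop.eventually_ge_atTop 2] with n h1 h2 h3 h4 han hbn hd hMpos hn hu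
  have hn' : (0 : ℝ) < n := by exact_mod_cast (by omega : 0 < n)
  have hdn := tailExponent_yDagger hν hn
  set u := Real.log n with hudef
  have hu0 : 0 < u := by linarith
  have hl : 0 < Real.log u := Real.log_pos (by linarith)
  have had : a n ≤ yDagger ν n :=
    (hν.monotone_tailExponent.reflect_lt (by rw [han, hdn]; linarith)).le
  have hdb : yDagger ν n ≤ b n :=
    (hν.monotone_tailExponent.reflect_lt (by rw [hbn, hdn]; linarith)).le
  have hexpd : Real.exp (-tailExponent ν (yDagger ν n)) = 1 / n := by
    rw [hdn, Real.exp_neg, hudef, Real.exp_log hn', one_div]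
  have hexpa : Real.exp (-tailExponent ν (a n)) = u ^ 2 / n := by
    rw [han, neg_sub, Real.exp_sub, hudef, Real.exp_log hn', mul_comm 2, Real.exp_mul,
      Real.exp_log hu0, Real.rpow_two]
  -- The mass is (u² - 1)/n, and u ≥ 2.
  have hIoca : 1 / (n : ℝ) ≤ ν.real (Ioc (a n) (yDagger ν n)) := by
    rw [hν.measureReal_Ioc had, hexpa, hexpd, ← sub_div]
    exact div_le_div_of_nonneg_right (by nlinarith) hn'.le
  have hup := empirical_le_mul_setIntegral (y := fun k => Y k ω) (hq0 n) (by omega) (ha0 n) had hdb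
    (by linarith) hc hd.2 hIoca (by rw [hν.measureReal_Ioi, hexpd]) h2 h3.le
  have hlow := setIntegral_le_mul_empirical (y := fun k => Y k ω) (hq0 n) (by omega) (ha0 n) had
    hdb (by linarith) hc (by rw [hν.measureReal_Ioi, hexpa]) h1 h4
  rw [← hν.truncatedMoment_eq (q n) hd.1, ← sampleMoment_exp] at hup hlow
  have hSpos : 0 < sampleMoment (fun k ω => Real.exp (Y k ω)) n (q n) ω := by
    rw [sampleMoment_exp]
    exact div_pos (Finset.sum_pos (fun k _ => Real.exp_pos _)
      (Finset.nonempty_range_iff.mpr (by omega))) hn'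
  have hK : 0 < 2 / c + 23 := by positivity
  have h := abs_log_sub_log_le hSpos hMpos (by positivity) hup hlow
  rw [Real.log_mul (by positivity) (by positivity), Real.log_mul (by positivity) (by positivity),
    Real.log_exp, Real.log_pow] at h
  rw [← sub_div, Real.norm_eq_abs, abs_div, abs_of_pos hu0, ← mul_div_assoc, ← add_div, ← add_div]
  exact div_le_div_of_nonneg_right (by exact_mod_cast h) hu0.le

/-- Addition on the extended reals is continuous at (l, 0) even for infinite l, because 0 is finite.
-/
theorem tendsto_coe_ereal_of_tendsto_sub {ι : Type*} {F : Filter ι} {x y : ι → ℝ} {l : EReal}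
    (h : Tendsto (fun i => y i - x i) F (𝓝 0))
    (hx : Tendsto (fun i => (x i : EReal)) F (𝓝 l)) : Tendsto (fun i => (y i : EReal)) F (𝓝 l) := by
  have h0 : Tendsto (fun i => ((y i - x i : ℝ) : EReal)) F (𝓝 ((0 : ℝ) : EReal)) :=
    (continuous_coe_real_ereal.tendsto 0).comp h
  have hadd := (EReal.continuousAt_add (p := (l, ((0 : ℝ) : EReal)))
    (Or.inr (EReal.coe_ne_bot 0)) (Or.inr (EReal.coe_ne_top 0))).tendsto.comp
    (hx.prodMk_nhds h0)
  simp only [EReal.coe_zero, add_zero] at hadd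
  refine hadd.congr fun i => ?_
  simp only [Function.comp_apply, ← EReal.coe_add]
  congr 1; ring

end LogExpPower
theorem mainTheorem1 {Ω : Type*} [MeasurableSpace Ω] (μ : Measure Ω) [IsProbabilityMeasure μ]
    (ρ : ℝ) (Y : ℕ → Ω → ℝ)
    (hmeas : ∀ k, Measurable (Y k))
    (hindep : iIndepFun Y μ)
    (hident : ∀ k, IdentDistrib (Y k) (Y 0) μ μ)
    (hclass : LogExpPower.IsLogExpPower (μ.map (Y 0)) ρ)
    (q : ℕ → ℝ) (hq_nonneg : ∀ n, 0 ≤ q n)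
    (hq : ∃ ε : ℝ, 0 < ε ∧
      q =o[atTop] fun n : ℕ => Real.log (n : ℝ) ^ (2 - 1 / ρ - ε)) :
    (∀ᶠ n in atTop, 0 < LogExpPower.truncatedMoment (μ.map (Y 0)) n (q n)) ∧
    (∀ᵐ ω ∂μ, Tendsto (fun n : ℕ =>
        Real.log (LogExpPower.sampleMoment (fun k ω => Real.exp (Y k ω)) n (q n) ω)
            / Real.log (n : ℝ)
          - Real.log (LogExpPower.truncatedMoment (μ.map (Y 0)) n (q n)) / Real.log (n : ℝ))
      atTop (𝓝 0)) ∧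
    ∀ l : EReal,
      Tendsto (fun n : ℕ =>
        ((Real.log (LogExpPower.truncatedMoment (μ.map (Y 0)) n (q n))
            / Real.log (n : ℝ) : ℝ) : EReal)) atTop (𝓝 l) →
      ∀ᵐ ω ∂μ, Tendsto (fun n : ℕ =>
        ((Real.log (LogExpPower.sampleMoment (fun k ω => Real.exp (Y k ω)) n (q n) ω)
            / Real.log (n : ℝ) : ℝ) : EReal)) atTop (𝓝 l) := by
  have : IsProbabilityMeasure (μ.map (Y 0)) :=
    Measure.isProbabilityMeasure_map (hmeas 0).aemeasurable
  obtain ⟨ε, hε, hqε⟩ := hq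
  have hlim := LogExpPower.ae_tendsto_log_sampleMoment_sub hmeas hindep hident hclass hq_nonneg
    hε hqε
  refine ⟨hclass.eventually_truncatedMoment_pos hq_nonneg, hlim, fun l hl => ?_⟩
  filter_upwards [hlim] with ω hω
  exact LogExpPower.tendsto_coe_ereal_of_tendsto_sub hω hl
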